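/- Let $n\ge 1$, $p\ge 2$, $s\in\{1,\dots,p\}$, $\sigma>0$, $\varepsilon>0$ and $c_0=1+1/\varepsilon$. Let $\mathbf f\in\mathbb R^n$ and $\mathbb X\in\mathbb R^{n\times p}$ be deterministic, let $\boldsymbol\xi\sim\mathcal N(\mathbf 0,\sigma^2 I_{n\times n})$, and let $\mathbf y=\mathbf f+\boldsymbol\xi$. Write $\|\mathbf u\|_n^2=\frac1n\sum_{i=1}^n u_i^2$ for $\mathbf u\in\mathbb R^n$ and, for $\boldsymbol\beta\in\mathbb R^p$, let $|\boldsymbol\beta|_0$ be the number of nonzero components of $\boldsymbol\beta$, $|\boldsymbol\beta|_q$ its $\ell_q$-norm ($q=1,2$), and $\beta_1^\sharp\ge\dots\ge\beta_p^\sharp$ the non-increasing rearrangement of $|\beta_1|,\dots,|\beta_p|$. Assume that $\mathbb X$ satisfies the condition $RE(s,c_0)$: the columns satisfy $\|\mathbb X\mathbf e_j\|_n\le 1$ for $j=1,\dots,p$, where $(\mathbf e_1,\dots,\mathbf e_p)$ is the canonical basis of $\mathbb R^p$, and $$\kappa(s,c_0)=\inf\left\{\frac{\|\mathbb X\mathbf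 u\|_n}{|\mathbf u|_2}\ :\ \mathbf u\in\mathbb R^p,\ \mathbf u\neq\mathbf 0,\ |\mathbf u|_1\le(1+c_0)\sum_{j=1}^s u_j^\sharp\right\}>0 .$$ Let $\hat{\boldsymbol\beta}$ be the Lasso estimator, that is, any (random) solution $$\hat{\boldsymbol\beta}\in\operatorname*{argmin}_{\boldsymbol\beta\in\mathbb R^p}\left(\|\mathbb X\boldsymbol\beta-\mathbf y\|_n^2+2\lambda|\boldsymbol\beta|_1\right),\qquad \lambda=(1+\varepsilon)\sigma\sqrt{\frac{2\log p}{n}} .$$ Then for every $\delta\in(0,1)$, with probability at least $1-\delta$, $$\|\mathbb X\hat{\boldsymbol\beta}-\mathbf f\|_n^2\le\inf_{\boldsymbol\beta\in\mathbb R^p:\,|\boldsymbol\beta|_0\le s}\|\mathbb X\boldsymbol\beta-\mathbf f\|_n^2+\frac{\sigma^2}{n}\left(\frac{(1+\varepsilon)\sqrt{2s\log p}}{\kappa(s,c_0)}+\sqrt s+\sqrt{2\log(1/\delta)}+2.8\right)^2 .$$ In particular, the estimator $\hat{\boldsymbol\beta}$ and the tuning parameter $\lambda$ do not depend on $\delta$.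 -/

import Mathlib

open MeasureTheory ProbabilityTheory

noncomputable section

/-- The empirical norm `‖u‖ₙ = ((1/n) ∑ᵢ uᵢ²)^{1/2}` on `ℝⁿ`. -/
def empNorm {n : ℕ} (u : Fin n → ℝ) : ℝ :=
  Real.sqrt ((1 / (n : ℝ)) * ∑ i, u i ^ 2)

/-- The number `|β|₀` of nonzero components of `β`. -/
def l0Norm {p : ℕ} (β : Fin p → ℝ) : ℕ :=
  (Finset.univ.filter fun j => β j ≠ 0).card

/-- The norm `|β|₁ = ∑ⱼ |βⱼ|`. -/
def l1Norm {p : ℕ} (β : Fin p → ℝ) : ℝ :=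
  ∑ j, |β j|

/-- The norm `|β|₂ = (∑ⱼ |βⱼ|²)^{1/2}`. -/
def l2Norm {p : ℕ} (β : Fin p → ℝ) : ℝ :=
  Real.sqrt (∑ j, |β j| ^ 2)

/-- The non-increasing rearrangement `δ♯` of `(|δ₁|, …, |δₚ|)`: `Tuple.sort` of `j ↦ -|δⱼ|` is a
permutation that lists the indices by decreasing `|δⱼ|`. -/
def decrRearr {p : ℕ} (δ : Fin p → ℝ) : Fin p → ℝ :=
  fun j => |δ (Tuple.sort (fun i => -|δ i|) j)|

/-- The cone of all `δ ∈ ℝᵖ` with `|δ|₁ ≤ (1 + c₀) ∑_{j ≤ s} δ♯ⱼ` (the components are indexed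
from `0`, so the first `s` of them are those with index `< s`). -/
def reCone (p s : ℕ) (c₀ : ℝ) : Set (Fin p → ℝ) :=
  {δ | l1Norm δ ≤ (1 + c₀) * ∑ j : Fin p with j.val < s, decrRearr δ j}

/-- The restricted eigenvalue constant `κ(s, c₀)` of the design matrix `X`: the infimum of
`‖Xδ‖ₙ / |δ|₂` over the nonzero elements `δ` of the cone. -/
def reConst {n p : ℕ} (X : Matrix (Fin n) (Fin p) ℝ) (s : ℕ) (c₀ : ℝ) : ℝ :=
  sInf ((fun δ => empNorm (X.mulVec δ) / l2Norm δ) '' {δ | δ ∈ reCone p s c₀ ∧ δ ≠ 0})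

/-- The restricted eigenvalue condition `RE(s, c₀)`: the columns `X eⱼ` satisfy `‖X eⱼ‖ₙ ≤ 1`,
and `κ(s, c₀) > 0`. -/
def RECondition {n p : ℕ} (X : Matrix (Fin n) (Fin p) ℝ) (s : ℕ) (c₀ : ℝ) : Prop :=
  (∀ j, empNorm (X.mulVec (Pi.single j 1)) ≤ 1) ∧ 0 < reConst X s c₀

/-- `b` is a Lasso solution for the design `X`, the observation `y` and the tuning parameter `lam`:
it minimizes `‖Xβ - y‖ₙ² + 2 lam |β|₁` over all `β ∈ ℝᵖ`. -/
def IsLasso {n p : ℕ} (X : Matrix (Fin n) (Fin p) ℝ) (y : Fin n → ℝ) (lam : ℝ)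
    (b : Fin p → ℝ) : Prop :=
  ∀ β : Fin p → ℝ,
    empNorm (X.mulVec b - y) ^ 2 + 2 * lam * l1Norm b ≤
      empNorm (X.mulVec β - y) ^ 2 + 2 * lam * l1Norm β

end

/-!
The noise is `ξ = σ ζ` with `ζ` standard Gaussian. The infimum over sparse vectors is governed by one
deterministic support `S` of size `s` (`exists_support_le_iInf`); let `V` be the span of the columns
with index in `S`.

*Deterministic part* (`IsLasso.oracle_inequality`). Let `b` be the Lasso solution, `β` supported in
`S`, and `u = b - β`. Strong convexity of the quadratic loss gives
`‖Xb - f‖² ≤ ‖Xβ - f‖² + 2 (⟪ξ, Xu⟫ + n lam (|β|₁ - |b|₁)) - ‖Xu‖²`. Compare `ζ` with a vector `η`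
whose correlations with the columns outside `S`, after projecting out `V`, are at most
`√(2 n log p)`. Then `⟪ζ, Xu⟫` is at most `‖Xu‖ (‖ζ - η‖ + ‖P_V η‖)` plus a term absorbed by the
penalty, except for a multiple of `|u_S|₁` that matters only if `u` lies in the cone; there the
restricted eigenvalue condition applies.

*Probabilistic part* (`stdGaussian_enlargement_ge`). It remains to find, for `ζ` outside an event of
probability `δ`, such an `η` with `‖P_V η‖ + ‖ζ - η‖ < √s + √(2 log (1/δ)) + 2.8`. The exact constant
in front of `√(2 log (1/δ))` comes from the Prékopa–Leindler inequality for the Gaussian measure,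
with unequal weights (`prekopaLeindler_stdGaussian`): for sets at distance `d` it says that
`√(2 log (1/γ(A))) + √(2 log (1/γ(B))) ≥ d`. The version needed here also carries the weight
`exp (-c ‖P_V η‖)`, whose integral is controlled by Jensen's inequality, because the event on `η`
depends only on the component in `Vᗮ`, which is independent of `P_V η`. A union bound with Mills'
tail estimate (`stdGaussian_smallCorr_ge`) shows that the event has probability at least
`1/4 ≥ exp (-2.8²/2)`.
-/

open scoped RealInnerProductSpace

/-! ### The Prékopa–Leindler inequality -/

/-- One-dimensional Brunn–Minkowski inequality for compact sets: translating so that `max K` meets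
`min L`, the sumset contains translates of `K` and `L` that overlap in one point only. -/
lemma volume_add_le_of_isCompact {K L C : Set ℝ} (hK : IsCompact K) (hL : IsCompact L)
    (hKn : K.Nonempty) (hLn : L.Nonempty) (h : ∀ x ∈ K, ∀ y ∈ L, x + y ∈ C) :
    volume K + volume L ≤ volume C := by
  obtain ⟨a, haK, ha⟩ := hK.exists_isGreatest hKn
  obtain ⟨b, hbL, hb⟩ := hL.exists_isLeast hLn
  have h1 : volume ((fun x => x + b) '' K) = volume K := by
    simp [Set.image_add_right]
  have h2 : volume ((fun y => a + y) '' L) = volume L := by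
    simp [Set.image_add_left]
  have hd : AEDisjoint volume ((fun x => x + b) '' K) ((fun y => a + y) '' L) := by
    refine measure_mono_null (t := {a + b}) ?_ (by simp)
    rintro z ⟨⟨x, hx, rfl⟩, ⟨y, hy, hxy⟩⟩
    have := ha hx
    have := hb hy
    simp only [Set.mem_singleton_iff] at *
    linarith
  have hm : MeasurableSet ((fun y => a + y) '' L) :=
    (hL.image (by fun_prop)).measurableSet
  rw [← h1, ← h2, ← measure_union₀ hm.nullMeasurableSet hd]
  refine measure_mono ?_
  rintro z (⟨x, hx, rfl⟩ | ⟨y, hy, rfl⟩)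
  · exact h x hx b hbL
  · exact h a haK y hy

/-- One-dimensional Brunn–Minkowski inequality; `C` need not be measurable. -/
lemma volume_add_le {A B C : Set ℝ} (hA : MeasurableSet A) (hB : MeasurableSet B)
    (hAn : A.Nonempty) (hBn : B.Nonempty) (h : ∀ x ∈ A, ∀ y ∈ B, x + y ∈ C) :
    volume A + volume B ≤ volume C := by
  obtain ⟨a, ha⟩ := hAn
  obtain ⟨b, hb⟩ := hBn
  rw [hA.measure_eq_iSup_isCompact, hB.measure_eq_iSup_isCompact]
  simp only [iSup_and']
  refine ENNReal.biSup_add_biSup_le' ⟨∅, by simp⟩ ⟨∅, by simp⟩ ?_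
  rintro K ⟨hKA, hK⟩ L ⟨hLB, hL⟩
  -- adjoining a point makes the compact sets nonempty
  refine le_trans (add_le_add (measure_mono (Set.subset_insert a K))
    (measure_mono (Set.subset_insert b L)))
    (volume_add_le_of_isCompact (hK.insert a) (hL.insert b) (Set.insert_nonempty _ _)
      (Set.insert_nonempty _ _) fun x hx y hy => h x ?_ y ?_)
  · exact Set.insert_subset ha hKA hx
  · exact Set.insert_subset hb hLB hy

lemma volume_convexCombination_le {A B C : Set ℝ} {l m : ℝ} (hl : 0 < l) (hm : 0 < m)
    (hA : MeasurableSet A) (hB : MeasurableSet B)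
    (hAn : A.Nonempty) (hBn : B.Nonempty) (h : ∀ x ∈ A, ∀ y ∈ B, l * x + m * y ∈ C) :
    ENNReal.ofReal l * volume A + ENNReal.ofReal m * volume B ≤ volume C := by
  have key : ∀ (r : ℝ) (_ : 0 < r) (S : Set ℝ),
      volume ((fun x => r⁻¹ * x) ⁻¹' S) = ENNReal.ofReal r * volume S := by
    intro r hr S
    rw [Real.volume_preimage_mul_left (inv_ne_zero hr.ne'), inv_inv, abs_of_pos hr]
  rw [← key l hl, ← key m hm]
  refine volume_add_le (hA.preimage (by fun_prop)) (hB.preimage (by fun_prop)) ?_ ?_ ?_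
  · obtain ⟨a, ha⟩ := hAn
    exact ⟨l * a, by simpa [hl.ne'] using ha⟩
  · obtain ⟨b, hb⟩ := hBn
    exact ⟨m * b, by simpa [hm.ne'] using hb⟩
  · intro x hx y hy
    have := h _ hx _ hy
    simpa [← mul_assoc, hl.ne', hm.ne'] using this

open Set in
/-- Additive form of the one-dimensional Prékopa–Leindler inequality for functions with
supremum `1`: integrate the Brunn–Minkowski inequality over the level sets. -/
lemma lintegral_prekopaLeindler_of_sup_one {f g h : ℝ → ℝ} {l m : ℝ} (hl : 0 < l) (hm : 0 < m)
    (hlm : l + m = 1) (hf : Measurable f) (hg : Measurable g) (hh : Measurable h)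
    (hf0 : 0 ≤ f) (hg0 : 0 ≤ g) (hh0 : 0 ≤ h)
    (hf1 : IsLUB (range f) 1) (hg1 : IsLUB (range g) 1)
    (H : ∀ x y, f x ^ l * g y ^ m ≤ h (l * x + m * y)) :
    ENNReal.ofReal l * (∫⁻ x, ENNReal.ofReal (f x)) +
      ENNReal.ofReal m * (∫⁻ x, ENNReal.ofReal (g x)) ≤ ∫⁻ x, ENNReal.ofReal (h x) := by
  have trunc : ∀ u : ℝ → ℝ, Measurable u → 0 ≤ u → IsLUB (range u) 1 →
      ∫⁻ x, ENNReal.ofReal (u x) = ∫⁻ t in Ioo 0 1, volume {x | t < u x} := by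
    intro u hu hu0 hu1
    rw [lintegral_eq_lintegral_meas_lt _ (ae_of_all _ hu0) hu.aemeasurable,
      ← Ioo_union_Ici_eq_Ioi zero_lt_one,
      lintegral_union measurableSet_Ici (by
        rw [Set.disjoint_left]; intro x hx hx'; exact absurd hx.2 (not_lt.2 hx'))]
    have : ∫⁻ t in Ici (1 : ℝ), volume {x | t < u x} = 0 := by
      refine (setLIntegral_congr_fun measurableSet_Ici (g := fun _ => 0) ?_).trans (by simp)
      intro t ht
      have : {x | t < u x} = ∅ := by
        ext x
        simpa using (hu1.1 ⟨x, rfl⟩).trans ht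
      simp [this]
    rw [this, add_zero]
  have meas : ∀ u : ℝ → ℝ, Measurable (fun t : ℝ => volume {x | t < u x}) := by
    intro u
    refine Antitone.measurable fun s t hst => measure_mono fun x hx => ?_
    exact hst.trans_lt hx
  rw [trunc f hf hf0 hf1, trunc g hg hg0 hg1,
    lintegral_eq_lintegral_meas_lt _ (ae_of_all _ hh0) hh.aemeasurable,
    ← lintegral_const_mul _ (meas f), ← lintegral_const_mul _ (meas g),
    ← lintegral_add_left ((meas f).const_mul _)]
  refine (setLIntegral_mono ?_ ?_).trans (lintegral_mono_set Ioo_subset_Ioi_self)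
  · exact meas h
  intro t ht
  refine volume_convexCombination_le hl hm (measurableSet_lt measurable_const hf)
    (measurableSet_lt measurable_const hg) ?_ ?_ ?_
  · obtain ⟨_, ⟨x, rfl⟩, hx⟩ := (lt_isLUB_iff hf1).1 ht.2
    exact ⟨x, hx⟩
  · obtain ⟨_, ⟨x, rfl⟩, hx⟩ := (lt_isLUB_iff hg1).1 ht.2
    exact ⟨x, hx⟩
  · intro x hx y hy
    refine lt_of_lt_of_le ?_ (H x y)
    calc t = t ^ l * t ^ m := by rw [← Real.rpow_add ht.1, hlm, Real.rpow_one]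
      _ < f x ^ l * g y ^ m := by
        have h1 := Real.rpow_lt_rpow ht.1.le hx hl
        have h2 := Real.rpow_lt_rpow ht.1.le hy hm
        exact mul_lt_mul'' h1 h2 (Real.rpow_nonneg ht.1.le _) (Real.rpow_nonneg ht.1.le _)

/-- The one-dimensional Prékopa–Leindler inequality for bounded integrable functions. -/
lemma prekopaLeindler_real {f g h : ℝ → ℝ} {l m : ℝ} (hl : 0 < l) (hm : 0 < m)
    (hlm : l + m = 1) (hf : Measurable f) (hg : Measurable g) (hh : Measurable h)
    (hf0 : 0 ≤ f) (hg0 : 0 ≤ g) (hh0 : 0 ≤ h)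
    (hfb : BddAbove (Set.range f)) (hgb : BddAbove (Set.range g))
    (hfi : Integrable f) (hgi : Integrable g) (hhi : Integrable h)
    (H : ∀ x y, f x ^ l * g y ^ m ≤ h (l * x + m * y)) :
    (∫ x, f x) ^ l * (∫ x, g x) ^ m ≤ ∫ x, h x := by
  have hfl := isLUB_csSup (Set.range_nonempty f) hfb
  have hgl := isLUB_csSup (Set.range_nonempty g) hgb
  set M := sSup (Set.range f)
  set N := sSup (Set.range g)
  have hhn : 0 ≤ ∫ x, h x := integral_nonneg hh0
  have hM0 : 0 ≤ M := (hf0 0).trans (hfl.1 ⟨0, rfl⟩)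
  have hN0 : 0 ≤ N := (hg0 0).trans (hgl.1 ⟨0, rfl⟩)
  rcases hM0.eq_or_lt with hM | hM
  · have : f = 0 := by
      ext x; exact le_antisymm ((hfl.1 ⟨x, rfl⟩).trans hM.symm.le) (hf0 x)
    simpa [this, Real.zero_rpow hl.ne'] using hhn
  rcases hN0.eq_or_lt with hN | hN
  · have : g = 0 := by
      ext x; exact le_antisymm ((hgl.1 ⟨x, rfl⟩).trans hN.symm.le) (hg0 x)
    simpa [this, Real.zero_rpow hm.ne'] using hhn
  have lub : ∀ (u : ℝ → ℝ) (R : ℝ), 0 < R → IsLUB (Set.range u) R →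
      IsLUB (Set.range fun x => u x / R) 1 := by
    intro u R hR hu
    constructor
    · rintro _ ⟨x, rfl⟩
      exact (div_le_one hR).2 (hu.1 ⟨x, rfl⟩)
    · intro b hb
      have : R ≤ b * R := hu.2 (by
        rintro _ ⟨x, rfl⟩
        exact (div_le_iff₀ hR).1 (hb ⟨x, rfl⟩))
      exact le_of_mul_le_mul_right (by simpa using this) hR
  have hD : 0 < M ^ l * N ^ m := mul_pos (Real.rpow_pos_of_pos hM _) (Real.rpow_pos_of_pos hN _)
  have key := lintegral_prekopaLeindler_of_sup_one hl hm hlm (hf.div_const M) (hg.div_const N)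
    (hh.div_const (M ^ l * N ^ m)) (fun x => div_nonneg (hf0 x) hM.le)
    (fun x => div_nonneg (hg0 x) hN.le) (fun x => div_nonneg (hh0 x) hD.le)
    (lub f M hM hfl) (lub g N hN hgl) (by
      intro x y
      rw [Real.div_rpow (hf0 x) hM.le, Real.div_rpow (hg0 y) hN.le, div_mul_div_comm]
      exact div_le_div_of_nonneg_right (H x y) hD.le)
  rw [← ofReal_integral_eq_lintegral_ofReal (hfi.div_const M)
      (ae_of_all _ fun x => div_nonneg (hf0 x) hM.le),
    ← ofReal_integral_eq_lintegral_ofReal (hgi.div_const N)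
      (ae_of_all _ fun x => div_nonneg (hg0 x) hN.le),
    ← ofReal_integral_eq_lintegral_ofReal (hhi.div_const _)
      (ae_of_all _ fun x => div_nonneg (hh0 x) hD.le), ← ENNReal.ofReal_mul hl.le,
    ← ENNReal.ofReal_mul hm.le, integral_div, integral_div, integral_div] at key
  have hF : 0 ≤ ∫ x, f x := integral_nonneg hf0
  have hG : 0 ≤ ∫ x, g x := integral_nonneg hg0
  rw [← ENNReal.ofReal_add (by positivity) (by positivity),
    ENNReal.ofReal_le_ofReal_iff (by positivity)] at key
  have amgm := Real.geom_mean_le_arith_mean2_weighted hl.le hm.le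
    (div_nonneg hF hM.le) (div_nonneg hG hN.le) hlm
  have := amgm.trans key
  rw [Real.div_rpow hF hM.le, Real.div_rpow hG hN.le, div_mul_div_comm] at this
  exact (div_le_div_iff_of_pos_right hD).1 this

/-- Prékopa–Leindler inequality for the standard Gaussian measure on `ℝ` and a constant third
function. -/
lemma prekopaLeindler_gaussianReal {f g : ℝ → ℝ} {l m K : ℝ} (hl : 0 < l) (hm : 0 < m)
    (hlm : l + m = 1) (hf : Measurable f) (hg : Measurable g)
    (hf0 : ∀ x, 0 ≤ f x) (hg0 : ∀ x, 0 ≤ g x) (hf1 : ∀ x, f x ≤ 1) (hg1 : ∀ x, g x ≤ 1)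
    (H : ∀ x y, f x ^ l * g y ^ m ≤ K * Real.exp (l * m * (x - y) ^ 2 / 2)) :
    (∫ x, f x ∂(gaussianReal 0 1)) ^ l * (∫ x, g x ∂(gaussianReal 0 1)) ^ m ≤ K := by
  have hK : 0 ≤ K := by
    have := H 0 0
    simp only [sub_self] at this
    have h2 : 0 ≤ f 0 ^ l * g 0 ^ m :=
      mul_nonneg (Real.rpow_nonneg (hf0 0) _) (Real.rpow_nonneg (hg0 0) _)
    simpa using h2.trans this
  set φ := gaussianPDFReal 0 1 with hφ
  have hφm : Measurable φ := measurable_gaussianPDFReal 0 1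
  have hφ0 : ∀ x, 0 ≤ φ x := gaussianPDFReal_nonneg 0 1
  have hφi : Integrable φ := integrable_gaussianPDFReal 0 1
  have hφe : ∀ x, φ x = (√(2 * Real.pi))⁻¹ * Real.exp (- x ^ 2 / 2) := by
    intro x; simp [hφ, gaussianPDFReal]
  set c := (√(2 * Real.pi))⁻¹ with hc
  have hc0 : 0 < c := by positivity
  have hφb : ∀ x, φ x ≤ c := by
    intro x
    rw [hφe]
    have : Real.exp (- x ^ 2 / 2) ≤ 1 := Real.exp_le_one_iff.2 (by nlinarith [sq_nonneg x])
    nlinarith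
  have int : ∀ u : ℝ → ℝ, Measurable u → (∀ x, 0 ≤ u x) → (∀ x, u x ≤ 1) →
      Integrable (fun x => φ x * u x) := by
    intro u hu hu0 hu1
    refine hφi.mono (hφm.mul hu).aestronglyMeasurable (ae_of_all _ fun x => ?_)
    rw [norm_mul, Real.norm_of_nonneg (hu0 x)]
    exact mul_le_of_le_one_right (norm_nonneg _) (hu1 x)
  have bdd : ∀ u : ℝ → ℝ, (∀ x, 0 ≤ u x) → (∀ x, u x ≤ 1) →
      BddAbove (Set.range (fun x => φ x * u x)) := by
    intro u hu0 hu1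
    refine ⟨c, ?_⟩
    rintro _ ⟨x, rfl⟩
    exact (mul_le_of_le_one_right (hφ0 x) (hu1 x)).trans (hφb x)
  rw [integral_gaussianReal_eq_integral_smul one_ne_zero,
    integral_gaussianReal_eq_integral_smul one_ne_zero]
  simp only [smul_eq_mul]
  have key := prekopaLeindler_real (h := fun x => φ x * K) hl hm hlm (hφm.mul hf) (hφm.mul hg)
    (hφm.mul_const K) (fun x => mul_nonneg (hφ0 x) (hf0 x)) (fun x => mul_nonneg (hφ0 x) (hg0 x))
    (fun x => mul_nonneg (hφ0 x) hK) (bdd f hf0 hf1) (bdd g hg0 hg1) (int f hf hf0 hf1)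
    (int g hg hg0 hg1) (hφi.mul_const K) (by
      intro x y
      simp only [Pi.mul_apply]
      rw [Real.mul_rpow (hφ0 x) (hf0 x), Real.mul_rpow (hφ0 y) (hg0 y)]
      have e : φ x ^ l * φ y ^ m * Real.exp (l * m * (x - y) ^ 2 / 2) = φ (l * x + m * y) := by
        simp only [hφe]
        rw [Real.mul_rpow hc0.le (Real.exp_pos _).le, Real.mul_rpow hc0.le (Real.exp_pos _).le,
          ← Real.exp_mul, ← Real.exp_mul]
        have hcc : c ^ l * c ^ m = c := by rw [← Real.rpow_add hc0, hlm, Real.rpow_one]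
        calc _ = (c ^ l * c ^ m) * (Real.exp (-x ^ 2 / 2 * l) * Real.exp (-y ^ 2 / 2 * m) *
              Real.exp (l * m * (x - y) ^ 2 / 2)) := by ring
          _ = _ := by
            rw [hcc, ← Real.exp_add, ← Real.exp_add]
            congr 2
            have hm' : m = 1 - l := by linarith
            subst hm'
            ring
      calc _ = (φ x ^ l * φ y ^ m) * (f x ^ l * g y ^ m) := by ring
        _ ≤ (φ x ^ l * φ y ^ m) * (K * Real.exp (l * m * (x - y) ^ 2 / 2)) :=
          mul_le_mul_of_nonneg_left (H x y)
            (mul_nonneg (Real.rpow_nonneg (hφ0 x) _) (Real.rpow_nonneg (hφ0 y) _))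
        _ = φ (l * x + m * y) * K := by rw [← e]; ring)
  rw [integral_mul_const, hφ, integral_gaussianPDFReal_eq_one 0 one_ne_zero, one_mul] at key
  exact key

/-- Tensorization: with a constant third function the Gaussian Prékopa–Leindler inequality passes to
products, since freezing one coordinate only changes the constant. -/
lemma prekopaLeindler_pi_gaussianReal {l m : ℝ} (hl : 0 < l) (hm : 0 < m) (hlm : l + m = 1) :
    ∀ (n : ℕ) {f g : (Fin n → ℝ) → ℝ} {K : ℝ}, Measurable f → Measurable g →
    (∀ x, 0 ≤ f x) → (∀ x, 0 ≤ g x) → (∀ x, f x ≤ 1) → (∀ x, g x ≤ 1) →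
    (∀ x y, f x ^ l * g y ^ m ≤ K * Real.exp (l * m * (∑ i, (x i - y i) ^ 2) / 2)) →
    (∫ x, f x ∂(Measure.pi fun _ => gaussianReal 0 1)) ^ l *
      (∫ x, g x ∂(Measure.pi fun _ => gaussianReal 0 1)) ^ m ≤ K := by
  intro n
  induction n with
  | zero =>
    intro f g K hf hg hf0 hg0 hf1 hg1 H
    have := H isEmptyElim isEmptyElim
    rw [Measure.pi_of_empty _ isEmptyElim]
    simpa using this
  | succ n ih =>
    intro f g K hf hg hf0 hg0 hf1 hg1 H
    set γ := Measure.pi fun _ : Fin n => gaussianReal 0 1 with hγ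
    have mp := (measurePreserving_piFinSuccAbove (fun _ : Fin (n + 1) => gaussianReal 0 1) 0).symm
    have hcons : Measurable fun z : ℝ × (Fin n → ℝ) => (Fin.cons z.1 z.2 : Fin (n + 1) → ℝ) := by
      refine measurable_pi_iff.2 fun i => ?_
      refine Fin.cases ?_ (fun j => ?_) i
      · simpa using measurable_fst
      · simpa using by fun_prop
    have split : ∀ u : (Fin (n + 1) → ℝ) → ℝ, Measurable u → (∀ x, 0 ≤ u x) → (∀ x, u x ≤ 1) →
        ∫ x, u x ∂(Measure.pi fun _ => gaussianReal 0 1) =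
          ∫ a, ∫ x, u (Fin.cons a x) ∂γ ∂(gaussianReal 0 1) := by
      intro u hu hu0 hu1
      rw [← mp.integral_comp']
      simp_rw [MeasurableEquiv.piFinSuccAbove_symm_apply, Fin.insertNthEquiv,
        Fin.insertNth_zero, Equiv.coe_fn_mk]
      rw [integral_prod]
      · rfl
      · refine Integrable.of_bound (C := 1) (hu.comp hcons).aestronglyMeasurable
          (ae_of_all _ fun z => ?_)
        rw [Real.norm_of_nonneg (hu0 _)]
        exact hu1 _
    have meas : ∀ u : (Fin (n + 1) → ℝ) → ℝ, Measurable u →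
        Measurable fun a => ∫ x, u (Fin.cons a x) ∂γ := by
      intro u hu
      exact ((hu.comp hcons).stronglyMeasurable.integral_prod_right').measurable
    have le1 : ∀ u : (Fin (n + 1) → ℝ) → ℝ, Measurable u → (∀ x, 0 ≤ u x) → (∀ x, u x ≤ 1) →
        ∀ a, ∫ x, u (Fin.cons a x) ∂γ ≤ 1 := by
      intro u hu hu0 hu1 a
      refine (integral_mono_of_nonneg (ae_of_all _ fun x => hu0 _) (integrable_const (1 : ℝ))
        (ae_of_all _ fun x => hu1 _)).trans (by simp)
    rw [split f hf hf0 hf1, split g hg hg0 hg1]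
    refine prekopaLeindler_gaussianReal hl hm hlm (meas f hf) (meas g hg)
      (fun a => integral_nonneg fun x => hf0 _) (fun a => integral_nonneg fun x => hg0 _)
      (le1 f hf hf0 hf1) (le1 g hg hg0 hg1) fun a b => ?_
    refine ih (hf.comp (hcons.comp (by fun_prop : Measurable fun x : Fin n → ℝ => (a, x))))
      (hg.comp (hcons.comp (by fun_prop : Measurable fun x : Fin n → ℝ => (b, x))))
      (fun x => hf0 _) (fun x => hg0 _) (fun x => hf1 _) (fun x => hg1 _) fun x y => ?_
    refine (H _ _).trans_eq ?_
    rw [mul_assoc K, ← Real.exp_add, Fin.sum_univ_succ]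
    simp only [Fin.cons_zero, Fin.cons_succ]
    congr 2
    ring

/-- Prékopa–Leindler inequality for the standard Gaussian measure on `ℝⁿ` and a constant third
function. -/
theorem prekopaLeindler_stdGaussian {n : ℕ} {l m K : ℝ} (hl : 0 < l) (hm : 0 < m)
    (hlm : l + m = 1) {f g : EuclideanSpace ℝ (Fin n) → ℝ} (hf : Measurable f) (hg : Measurable g)
    (hf0 : ∀ x, 0 ≤ f x) (hg0 : ∀ x, 0 ≤ g x) (hf1 : ∀ x, f x ≤ 1) (hg1 : ∀ x, g x ≤ 1)
    (H : ∀ x y, f x ^ l * g y ^ m ≤ K * Real.exp (l * m * ‖x - y‖ ^ 2 / 2)) :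
    (∫ x, f x ∂(stdGaussian (EuclideanSpace ℝ (Fin n)))) ^ l *
      (∫ x, g x ∂(stdGaussian (EuclideanSpace ℝ (Fin n)))) ^ m ≤ K := by
  have hT : Measurable (WithLp.toLp 2 : (Fin n → ℝ) → EuclideanSpace ℝ (Fin n)) := by fun_prop
  rw [← map_pi_eq_stdGaussian, integral_map hT.aemeasurable hf.aestronglyMeasurable,
    integral_map hT.aemeasurable hg.aestronglyMeasurable]
  refine prekopaLeindler_pi_gaussianReal hl hm hlm n (hf.comp hT) (hg.comp hT) (fun _ => hf0 _)
    (fun _ => hg0 _) (fun _ => hf1 _) (fun _ => hg1 _) fun x y => (H _ _).trans_eq ?_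
  rw [EuclideanSpace.real_norm_sq_eq]
  simp

/-! ### Standard Gaussian vectors -/

/-- Mills' bound for the upper Gaussian tail. -/
lemma gaussianReal_Ioi_le {t : ℝ} (ht : 0 < t) :
    (gaussianReal 0 1).real (Set.Ioi t) ≤
      (√(2 * Real.pi))⁻¹ * (Real.exp (-t ^ 2 / 2) / t) := by
  set c := (√(2 * Real.pi))⁻¹ with hc
  have hc0 : 0 ≤ c := by positivity
  have hφe : ∀ x, gaussianPDFReal 0 1 x = c * Real.exp (- x ^ 2 / 2) := by
    intro x; simp [gaussianPDFReal, hc]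
  have hd : ∀ x ∈ Set.Ici t, HasDerivAt (fun y : ℝ => -Real.exp (-y ^ 2 / 2))
      (x * Real.exp (-x ^ 2 / 2)) x := by
    intro x _
    have h1 : HasDerivAt (fun y : ℝ => -y ^ 2 / 2) (-x) x :=
      HasDerivAt.congr_deriv (((hasDerivAt_pow 2 x).neg).div_const 2) (by norm_num; ring)
    exact h1.exp.neg.congr_deriv (by ring)
  have hpos : ∀ x ∈ Set.Ioi t, 0 ≤ x * Real.exp (-x ^ 2 / 2) := fun x hx =>
    mul_nonneg (ht.le.trans (le_of_lt hx)) (Real.exp_pos _).le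
  have hlim : Filter.Tendsto (fun y : ℝ => -Real.exp (-y ^ 2 / 2)) Filter.atTop (nhds 0) := by
    rw [← neg_zero]
    refine (Real.tendsto_exp_atBot.comp ?_).neg
    refine Filter.Tendsto.atBot_div_const two_pos ?_
    exact Filter.tendsto_neg_atTop_atBot.comp (Filter.tendsto_pow_atTop two_ne_zero)
  have hint := integrableOn_Ioi_deriv_of_nonneg' hd hpos hlim
  have hval := integral_Ioi_of_hasDerivAt_of_nonneg' hd hpos hlim
  rw [measureReal_def, gaussianReal_apply_eq_integral 0 one_ne_zero,
    ENNReal.toReal_ofReal (setIntegral_nonneg measurableSet_Ioi fun x _ =>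
      gaussianPDFReal_nonneg 0 1 x)]
  calc ∫ x in Set.Ioi t, gaussianPDFReal 0 1 x
      ≤ ∫ x in Set.Ioi t, c / t * (x * Real.exp (-x ^ 2 / 2)) := by
        refine setIntegral_mono_on (integrable_gaussianPDFReal 0 1).integrableOn
          (hint.const_mul _) measurableSet_Ioi fun x hx => ?_
        rw [hφe]
        have : 1 ≤ x / t := (one_le_div ht).2 (le_of_lt hx)
        calc c * Real.exp (-x ^ 2 / 2) ≤ c * Real.exp (-x ^ 2 / 2) * (x / t) :=
              le_mul_of_one_le_right (by positivity) this
          _ = _ := by ring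
    _ = c * (Real.exp (-t ^ 2 / 2) / t) := by
        rw [integral_const_mul, hval]; ring

lemma gaussianReal_abs_gt_le {t : ℝ} (ht : 0 < t) :
    (gaussianReal 0 1).real {x | t < |x|} ≤
      2 * (√(2 * Real.pi))⁻¹ * (Real.exp (-t ^ 2 / 2) / t) := by
  have h1 : {x : ℝ | t < |x|} = Set.Ioi t ∪ (fun x => -x) ⁻¹' Set.Ioi t := by
    ext x; simp [lt_abs, lt_neg]
  have h2 : (gaussianReal 0 1).real ((fun x => -x) ⁻¹' Set.Ioi t) =
      (gaussianReal 0 1).real (Set.Ioi t) := by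
    rw [← map_measureReal_apply measurable_neg measurableSet_Ioi, gaussianReal_map_neg, neg_zero]
  rw [h1]
  refine (measureReal_union_le _ _).trans ?_
  rw [h2]
  linarith [gaussianReal_Ioi_le ht]

/-- At the level `√(2 log p)` the two-sided Gaussian tail is at most a fixed fraction of `1 / p`. -/
lemma gaussianReal_abs_gt_sqrt_two_log_le {p : ℕ} (hp : 2 ≤ p) :
    (gaussianReal 0 1).real {x | √(2 * Real.log p) < |x|} ≤ 3 / 4 / p := by
  have hp' : (2 : ℝ) ≤ p := by exact_mod_cast hp
  have hlog : 0.69 < Real.log p :=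
    lt_of_lt_of_le (by linarith [Real.log_two_gt_d9]) (Real.log_le_log two_pos hp')
  have ht : 0 < √(2 * Real.log p) := Real.sqrt_pos.2 (by linarith)
  refine (gaussianReal_abs_gt_le ht).trans ?_
  rw [neg_div, Real.exp_neg, Real.sq_sqrt (by linarith), mul_div_cancel_left₀ _ two_ne_zero,
    Real.exp_log (by linarith)]
  have h1 : (8 / 3 : ℝ) ≤ √(2 * Real.pi) * √(2 * Real.log p) := by
    rw [← Real.sqrt_mul (by positivity)]
    refine Real.le_sqrt_of_sq_le ?_
    nlinarith [Real.pi_gt_three, mul_lt_mul'' Real.pi_gt_three hlog (by norm_num) (by norm_num)]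
  calc 2 * (√(2 * Real.pi))⁻¹ * ((p : ℝ)⁻¹ / √(2 * Real.log p))
      = 2 / (√(2 * Real.pi) * √(2 * Real.log p)) / p := by field_simp
    _ ≤ 3 / 4 / p := by
        refine div_le_div_of_nonneg_right ?_ (by linarith)
        rw [div_le_div_iff₀ (by linarith) (by norm_num)]
        linarith

lemma norm_starProjection_sq_eq_sum {E : Type*} [NormedAddCommGroup E]
    [InnerProductSpace ℝ E] [FiniteDimensional ℝ E] (V : Submodule ℝ E) (x : E) :
    ‖V.starProjection x‖ ^ 2 = ∑ i, ⟪(stdOrthonormalBasis ℝ V i : E), x⟫ ^ 2 := by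
  have h := (stdOrthonormalBasis ℝ V).sum_sq_inner_right (V.orthogonalProjectionOnto x)
  rw [Submodule.starProjection_apply, ← Submodule.coe_norm, ← h]
  refine Finset.sum_congr rfl fun i _ => ?_
  rw [Submodule.inner_orthogonalProjectionOnto_eq_of_mem_left]

section
variable {E : Type*} [NormedAddCommGroup E] [InnerProductSpace ℝ E] [FiniteDimensional ℝ E]
  [MeasurableSpace E] [BorelSpace E]


lemma map_inner_stdGaussian (w : E) :
    (stdGaussian E).map (fun x => ⟪w, x⟫) = gaussianReal 0 (‖w‖ ^ 2).toNNReal := by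
  have := IsGaussian.map_eq_gaussianReal (μ := stdGaussian E) (innerSL ℝ w)
  rw [integral_strongDual_stdGaussian, variance_dual_stdGaussian, innerSL_apply_norm] at this
  exact this

lemma integral_inner_sq_stdGaussian (w : E) :
    ∫ x, ⟪w, x⟫ ^ 2 ∂(stdGaussian E) = ‖w‖ ^ 2 := by
  have h := variance_dual_stdGaussian (innerSL ℝ w)
  rw [variance_of_integral_eq_zero (by fun_prop) (integral_strongDual_stdGaussian _),
    innerSL_apply_norm] at h
  exact h

lemma integrable_inner_sq_stdGaussian (w : E) :
    Integrable (fun x => ⟪w, x⟫ ^ 2) (stdGaussian E) := by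
  have : MemLp (fun x => ⟪w, x⟫) 2 (stdGaussian E) :=
    (innerSL ℝ w).comp_memLp' IsGaussian.memLp_two_id
  exact this.integrable_sq

/-- Tail of a one-dimensional marginal of variance at most `n`. -/
lemma stdGaussian_abs_inner_gt_le {p n : ℕ} (hp : 2 ≤ p) {w : E} (hw : ‖w‖ ^ 2 ≤ n) :
    (stdGaussian E).real {x | √(2 * n * Real.log p) < |⟪w, x⟫|} ≤ 3 / 4 / p := by
  rcases eq_or_ne w 0 with rfl | hw0
  · have : {x : E | √(2 * n * Real.log p) < |⟪(0 : E), x⟫|} = ∅ := by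
      refine Set.eq_empty_of_forall_notMem fun x => ?_
      rw [Set.mem_ofPred_eq, inner_zero_left, abs_zero]
      exact not_lt.2 (Real.sqrt_nonneg _)
    rw [this]
    simp only [measureReal_empty]
    positivity
  have hwn : 0 < ‖w‖ := norm_pos_iff.2 hw0
  have hu : ‖‖w‖⁻¹ • w‖ = 1 := by rw [norm_smul]; simp [hwn.ne']
  refine le_trans ?_ (gaussianReal_abs_gt_sqrt_two_log_le hp)
  have := map_inner_stdGaussian (‖w‖⁻¹ • w)
  rw [hu, one_pow, Real.toNNReal_one] at this
  rw [← this, map_measureReal_apply (by fun_prop) (measurableSet_lt (by fun_prop) (by fun_prop))]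
  refine measureReal_mono ?_
  intro x hx
  simp only [Set.mem_ofPred_eq, Set.mem_preimage, real_inner_smul_left, abs_mul, abs_inv,
    abs_norm] at hx ⊢
  rw [inv_mul_eq_div, lt_div_iff₀ hwn]
  refine lt_of_le_of_lt ?_ hx
  have h1 : ‖w‖ ≤ √n := Real.le_sqrt_of_sq_le hw
  calc √(2 * Real.log p) * ‖w‖ ≤ √(2 * Real.log p) * √n :=
        mul_le_mul_of_nonneg_left h1 (Real.sqrt_nonneg _)
    _ = √(2 * n * Real.log p) := by
        rw [← Real.sqrt_mul (by have := Real.log_natCast_nonneg p; positivity)]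
        ring_nf

/-- The components of a standard Gaussian vector in `V` and `Vᗮ` are jointly Gaussian and
uncorrelated, hence independent. -/
lemma indepFun_starProjection_stdGaussian (V : Submodule ℝ E) :
    IndepFun V.starProjection Vᗮ.starProjection (stdGaussian E) := by
  refine HasGaussianLaw.indepFun_of_covariance_inner ⟨?_⟩ fun x y => ?_
  · have : (fun ω => (V.starProjection ω, Vᗮ.starProjection ω)) =
        ⇑(V.starProjection.prod Vᗮ.starProjection) := rfl
    rw [this]
    infer_instance
  · have e : ∀ (W : Submodule ℝ E) (x : E), (fun ω => ⟪x, W.starProjection ω⟫) =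
        fun ω => ⟪W.starProjection x, ω⟫ := by
      intro W x
      ext ω
      exact (W.inner_starProjection_left_eq_right x ω).symm
    rw [e, e, ← covarianceBilin_apply_eq_cov IsGaussian.memLp_two_id, covarianceBilin_stdGaussian]
    exact Submodule.inner_right_of_mem_orthogonal (V.starProjection_apply_mem x)
      (Vᗮ.starProjection_apply_mem y)

lemma integrable_norm_starProjection_sq_stdGaussian (V : Submodule ℝ E) :
    Integrable (fun x => ‖V.starProjection x‖ ^ 2) (stdGaussian E) := by
  simp_rw [norm_starProjection_sq_eq_sum]
  exact integrable_finsetSum _ fun i _ => integrable_inner_sq_stdGaussian _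

lemma integral_norm_starProjection_sq_stdGaussian (V : Submodule ℝ E) :
    ∫ x, ‖V.starProjection x‖ ^ 2 ∂(stdGaussian E) = Module.finrank ℝ V := by
  simp_rw [norm_starProjection_sq_eq_sum]
  rw [integral_finsetSum _ fun i _ => integrable_inner_sq_stdGaussian _]
  simp_rw [integral_inner_sq_stdGaussian, ← Submodule.coe_norm, OrthonormalBasis.norm_eq_one]
  simp

/-- Jensen's inequality for `exp (-c ‖P_V x‖)`, combined with `E ‖P_V x‖² = dim V`. -/
lemma exp_neg_le_integral_exp_neg_norm_starProjection (V : Submodule ℝ E) {c r : ℝ} (hc : 0 ≤ c)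
    (hr : 0 < r) (hV : (Module.finrank ℝ V : ℝ) ≤ r ^ 2) :
    Real.exp (-(c * r)) ≤ ∫ x, Real.exp (-(c * ‖V.starProjection x‖)) ∂(stdGaussian E) := by
  have hi := (integrable_norm_starProjection_sq_stdGaussian V)
  have hi₁ : Integrable (fun x => ‖V.starProjection x‖ ^ 2 / r - r) (stdGaussian E) :=
    (hi.div_const r).sub (integrable_const r)
  have hi₂ : Integrable (fun x => c / 2 * (‖V.starProjection x‖ ^ 2 / r - r)) (stdGaussian E) :=
    hi₁.const_mul _
  have hi' : Integrable (fun x => Real.exp (-(c * r)) *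
      (1 - c / 2 * (‖V.starProjection x‖ ^ 2 / r - r))) (stdGaussian E) :=
    ((integrable_const 1).sub hi₂).const_mul _
  calc Real.exp (-(c * r)) ≤ Real.exp (-(c * r)) * (1 - c / 2 * (Module.finrank ℝ V / r - r)) := by
        refine le_mul_of_one_le_right (Real.exp_pos _).le ?_
        have : (Module.finrank ℝ V : ℝ) / r ≤ r := by
          rw [div_le_iff₀ hr]; nlinarith
        nlinarith
    _ = ∫ x, Real.exp (-(c * r)) * (1 - c / 2 * (‖V.starProjection x‖ ^ 2 / r - r))
          ∂(stdGaussian E) := by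
        rw [integral_const_mul, integral_sub (integrable_const _) hi₂, integral_const_mul,
          integral_sub (hi.div_const r) (integrable_const r), integral_div,
          integral_norm_starProjection_sq_stdGaussian]
        simp
    _ ≤ _ := by
        refine integral_mono hi' ?_ fun x => ?_
        · refine Integrable.of_bound (C := 1) (Measurable.aestronglyMeasurable (by fun_prop))
            (ae_of_all _ fun x => ?_)
          rw [Real.norm_of_nonneg (Real.exp_pos _).le]
          exact Real.exp_le_one_iff.2 (by have := norm_nonneg (V.starProjection x); nlinarith)
        · set N := ‖V.starProjection x‖
          -- tangent line of `exp` at `-(c * r)`, then `2 N ≤ N ^ 2 / r + r`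
          have h1 : Real.exp (-(c * N)) = Real.exp (-(c * r)) * Real.exp (c * r - c * N) := by
            rw [← Real.exp_add]; ring_nf
          have h2 := Real.add_one_le_exp (c * r - c * N)
          have h3 : 2 * N ≤ N ^ 2 / r + r := by
            rw [← sub_le_iff_le_add, le_div_iff₀ hr]
            nlinarith [sq_nonneg (N - r)]
          simp only
          rw [h1]
          refine mul_le_mul_of_nonneg_left ?_ (Real.exp_pos _).le
          nlinarith

end

/-! ### Gaussian concentration -/

lemma isOpen_enlargement {E : Type*} [NormedAddCommGroup E] (A : Set E) (N : E → ℝ) (τ : ℝ) :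
    IsOpen {x | ∃ y, y ∈ A ∧ N y + ‖x - y‖ < τ} := by
  have : {x | ∃ y, y ∈ A ∧ N y + ‖x - y‖ < τ} = ⋃ y ∈ A, {x | N y + ‖x - y‖ < τ} := by
    ext x; simp
  rw [this]
  exact isOpen_biUnion fun y _ => isOpen_lt (by fun_prop) continuous_const

/-- Gaussian concentration for the enlargement of an event that depends only on the component of
`x` in `Vᗮ`, the cost of a point `y` of the event being the norm of its component in `V`. -/
theorem stdGaussian_enlargement_ge {n : ℕ} (V : Submodule ℝ (EuclideanSpace ℝ (Fin n)))
    {A : Set (EuclideanSpace ℝ (Fin n))} (hA : MeasurableSet A) {a r δ : ℝ} (ha : 0 < a)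
    (hr : 0 < r) (hV : (Module.finrank ℝ V : ℝ) ≤ r ^ 2)
    (hAa : Real.exp (-a ^ 2 / 2) ≤
      (stdGaussian (EuclideanSpace ℝ (Fin n))).real (Vᗮ.starProjection ⁻¹' A))
    (hδ : 0 < δ) (hδ1 : δ < 1) :
    1 - δ ≤ (stdGaussian (EuclideanSpace ℝ (Fin n))).real {x | ∃ y, Vᗮ.starProjection y ∈ A ∧
      ‖V.starProjection y‖ + ‖x - y‖ < r + √(2 * Real.log (1 / δ)) + a} := by
  set γ := stdGaussian (EuclideanSpace ℝ (Fin n)) with hγ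
  set t := √(2 * Real.log (1 / δ)) with ht
  have hlog : 0 < Real.log (1 / δ) := Real.log_pos ((one_lt_div hδ).2 hδ1)
  have ht0 : 0 < t := Real.sqrt_pos.2 (by linarith)
  have ht2 : t ^ 2 = 2 * Real.log (1 / δ) := Real.sq_sqrt (by linarith)
  set τ := r + t + a with hτ
  set U := {x : EuclideanSpace ℝ (Fin n) | ∃ y, Vᗮ.starProjection y ∈ A ∧
      ‖V.starProjection y‖ + ‖x - y‖ < τ} with hU
  have hUo : IsOpen U := isOpen_enlargement (Vᗮ.starProjection ⁻¹' A) _ τ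
  have hUm := hUo.measurableSet
  set A' := Vᗮ.starProjection ⁻¹' A with hA'
  have hA'm : MeasurableSet A' := hA.preimage (by fun_prop)
  rw [← not_lt]
  intro hlt
  have hB : δ < γ.real Uᶜ := by
    rw [probReal_compl_eq_one_sub hUm]; linarith
  -- the weights that balance the two Gaussian tails `t` and `a`
  set l := a / (t + a) with hl
  set m := t / (t + a) with hm
  have hl0 : 0 < l := by positivity
  have hm0 : 0 < m := by positivity
  have hlm : l + m = 1 := by rw [hl, hm]; field_simp; ring
  set θ := t + a with hθ
  have hθ0 : 0 < θ := by positivity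
  -- `f` indicates the bad set, and `g` weights the event by the cost of its points; when `x` is bad
  -- and `y` lies in the event, the cost of `y` is at least `τ - ‖x - y‖`
  have key := prekopaLeindler_stdGaussian (n := n) (K := Real.exp (-(l * m * (θ * τ - θ ^ 2 / 2))))
    hl0 hm0 hlm (f := Uᶜ.indicator fun _ => 1)
    (g := A'.indicator fun y => Real.exp (-(l * θ * ‖V.starProjection y‖)))
    (measurable_const.indicator hUm.compl)
    (Measurable.indicator (by fun_prop) hA'm)
    (fun x => Set.indicator_nonneg (fun _ _ => zero_le_one) x)
    (fun x => Set.indicator_nonneg (fun _ _ => (Real.exp_pos _).le) x)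
    (fun x => Set.indicator_le_self' (fun _ _ => zero_le_one) x)
    (fun x => by
      refine Set.indicator_apply_le' (fun _ => Real.exp_le_one_iff.2 ?_) fun _ => zero_le_one
      have := norm_nonneg (V.starProjection x)
      rw [neg_nonpos]
      positivity)
    (fun x y => by
      have hnn : 0 ≤ Real.exp (-(l * m * (θ * τ - θ ^ 2 / 2))) *
        Real.exp (l * m * ‖x - y‖ ^ 2 / 2) := by positivity
      by_cases hx : x ∈ Uᶜ
      swap
      · rw [Set.indicator_of_notMem hx, Real.zero_rpow hl0.ne', zero_mul]
        exact hnn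
      by_cases hy : y ∈ A'
      swap
      · rw [Set.indicator_of_notMem hy, Real.zero_rpow hm0.ne', mul_zero]
        exact hnn
      rw [Set.indicator_of_mem hx, Set.indicator_of_mem hy, Real.one_rpow, one_mul,
        ← Real.exp_mul, ← Real.exp_add, Real.exp_le_exp]
      have hxy : τ ≤ ‖V.starProjection y‖ + ‖x - y‖ := by
        by_contra hcon
        exact hx ⟨y, hy, not_le.1 hcon⟩
      have hlm0 : 0 < l * m := mul_pos hl0 hm0
      have : θ * τ - θ ^ 2 / 2 ≤ θ * ‖V.starProjection y‖ + ‖x - y‖ ^ 2 / 2 := by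
        nlinarith [sq_nonneg (θ - ‖x - y‖)]
      nlinarith)
  have hBi : ∫ x, Uᶜ.indicator (fun _ => (1 : ℝ)) x ∂γ = γ.real Uᶜ := by
    rw [integral_indicator_const _ hUm.compl]; simp
  -- independence factors out the probability of the event
  have hAi : γ.real A' * Real.exp (-(l * θ * r)) ≤
      ∫ y, A'.indicator (fun y => Real.exp (-(l * θ * ‖V.starProjection y‖))) y ∂γ := by
    have ind := (indepFun_starProjection_stdGaussian V).comp
      (φ := fun v => Real.exp (-(l * θ * ‖v‖))) (ψ := A.indicator fun _ => (1 : ℝ)) (_mγ' := Real.measurableSpace)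
      (by fun_prop) (measurable_const.indicator hA)
    have := ind.integral_fun_mul_eq_mul_integral
      (Measurable.aestronglyMeasurable (by fun_prop))
      (Measurable.aestronglyMeasurable ((measurable_const.indicator hA).comp (by fun_prop)))
    have e1 : ∫ y, A'.indicator (fun y => Real.exp (-(l * θ * ‖V.starProjection y‖))) y ∂γ =
        (∫ y, Real.exp (-(l * θ * ‖V.starProjection y‖)) ∂γ) * γ.real A' := by
      have e2 : ∫ y, A'.indicator (fun _ => (1 : ℝ)) y ∂γ = γ.real A' := by
        rw [integral_indicator_const _ hA'm]; simp
      rw [← e2]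
      refine Eq.trans ?_ this
      refine integral_congr_ae (ae_of_all _ fun y => ?_)
      by_cases hy : y ∈ A'
      · have : Vᗮ.starProjection y ∈ A := hy
        simp only [Set.indicator_of_mem hy, Function.comp_apply, Set.indicator_of_mem this, mul_one]
      · have : Vᗮ.starProjection y ∉ A := hy
        simp only [Set.indicator_of_notMem hy, Function.comp_apply, Set.indicator_of_notMem this,
          mul_zero]
    rw [e1, mul_comm]
    exact mul_le_mul_of_nonneg_right (exp_neg_le_integral_exp_neg_norm_starProjection V
      (by positivity) hr hV) measureReal_nonneg
  rw [hBi] at key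
  have h1 : Real.exp (-t ^ 2 / 2) < γ.real Uᶜ := by
    rwa [neg_div, ht2, mul_div_cancel_left₀ _ two_ne_zero, Real.exp_neg, Real.exp_log (by positivity),
      one_div, inv_inv]
  have h2 : Real.exp (-a ^ 2 / 2 - l * θ * r) ≤
      ∫ y, A'.indicator (fun y => Real.exp (-(l * θ * ‖V.starProjection y‖))) y ∂γ := by
    refine le_trans ?_ hAi
    rw [sub_eq_add_neg, Real.exp_add]
    exact mul_le_mul_of_nonneg_right hAa (Real.exp_pos _).le
  have h3 : Real.exp (-t ^ 2 / 2 * l + (-a ^ 2 / 2 - l * θ * r) * m) <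
      Real.exp (-(l * m * (θ * τ - θ ^ 2 / 2))) := by
    refine lt_of_lt_of_le ?_ key
    rw [Real.exp_add, Real.exp_mul, Real.exp_mul]
    exact mul_lt_mul (Real.rpow_lt_rpow (Real.exp_pos _).le h1 hl0)
      (Real.rpow_le_rpow (Real.exp_pos _).le h2 hm0.le) (Real.rpow_pos_of_pos (Real.exp_pos _) _)
      (Real.rpow_nonneg measureReal_nonneg _)
  rw [Real.exp_lt_exp] at h3
  -- both exponents are `-t * a / 2 - l * m * θ * r`
  refine absurd h3 (not_lt.2 (le_of_eq ?_))
  rw [hl, hm, hτ, hθ]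
  field_simp
  ring

/-! ### Deterministic analysis of the Lasso -/

lemma empNorm_sq_eq_sum {n : ℕ} (u : Fin n → ℝ) :
    empNorm u ^ 2 = 1 / (n : ℝ) * ∑ i, u i ^ 2 := by
  rw [empNorm, Real.sq_sqrt (by positivity)]

lemma empNorm_sq {n : ℕ} (u : Fin n → ℝ) : empNorm u ^ 2 = ‖WithLp.toLp 2 u‖ ^ 2 / n := by
  rw [empNorm_sq_eq_sum, EuclideanSpace.real_norm_sq_eq]
  simp
  ring

lemma empNorm_nonneg {n : ℕ} (u : Fin n → ℝ) : 0 ≤ empNorm u := Real.sqrt_nonneg _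

lemma norm_toLp_eq_sqrt_mul_empNorm {n : ℕ} (hn : 0 < n) (u : Fin n → ℝ) :
    ‖WithLp.toLp 2 u‖ = √n * empNorm u := by
  have hn' : (0 : ℝ) < n := by exact_mod_cast hn
  rw [← sq_eq_sq₀ (norm_nonneg _) (mul_nonneg (Real.sqrt_nonneg _) (empNorm_nonneg _)), mul_pow,
    empNorm_sq, Real.sq_sqrt hn'.le]
  field_simp

/-- The `j`-th column of `X`, as a vector of the Euclidean space. -/
def designCol {n p : ℕ} (X : Matrix (Fin n) (Fin p) ℝ) (j : Fin p) : EuclideanSpace ℝ (Fin n) :=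
  WithLp.toLp 2 (X.mulVec (Pi.single j 1))

lemma toLp_mulVec_eq_sum {n p : ℕ} (X : Matrix (Fin n) (Fin p) ℝ) (u : Fin p → ℝ) :
    WithLp.toLp 2 (X.mulVec u) = ∑ j, u j • designCol X j := by
  ext i
  simp [designCol, Matrix.mulVec, dotProduct, mul_comm]

/-- Strong convexity of the quadratic loss along the segment from a Lasso solution `b` to `β`
improves the minimality of `b` by the squared distance of the two predictions. -/
lemma IsLasso.add_sq_le {n p : ℕ} {X : Matrix (Fin n) (Fin p) ℝ} {y : Fin n → ℝ} {lam : ℝ}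
    {b : Fin p → ℝ} (hlam : 0 ≤ lam) (h : IsLasso X y lam b) (β : Fin p → ℝ) :
    empNorm (X.mulVec b - y) ^ 2 + 2 * lam * l1Norm b + empNorm (X.mulVec (b - β)) ^ 2 ≤
      empNorm (X.mulVec β - y) ^ 2 + 2 * lam * l1Norm β := by
  set D := empNorm (X.mulVec (b - β)) ^ 2 with hD
  have hD0 : 0 ≤ D := sq_nonneg _
  have seg : ∀ t : ℝ, 0 < t → t < 1 →
      empNorm (X.mulVec b - y) ^ 2 + 2 * lam * l1Norm b + (1 - t) * D ≤
        empNorm (X.mulVec β - y) ^ 2 + 2 * lam * l1Norm β := by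
    intro t ht ht1
    have h0 := h ((1 - t) • b + t • β)
    have hl1 : l1Norm ((1 - t) • b + t • β) ≤ (1 - t) * l1Norm b + t * l1Norm β := by
      simp only [l1Norm, Finset.mul_sum, ← Finset.sum_add_distrib]
      refine Finset.sum_le_sum fun j _ => ?_
      refine (abs_add_le _ _).trans_eq ?_
      simp only [Pi.smul_apply, smul_eq_mul, abs_mul, abs_of_pos ht, abs_of_pos (sub_pos.2 ht1)]
    have hq : empNorm (X.mulVec ((1 - t) • b + t • β) - y) ^ 2 =
        (1 - t) * empNorm (X.mulVec b - y) ^ 2 + t * empNorm (X.mulVec β - y) ^ 2 -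
          t * (1 - t) * D := by
      simp only [hD, empNorm_sq_eq_sum, Matrix.mulVec_add, Matrix.mulVec_smul, Matrix.mulVec_sub]
      have : ∀ (a c : ℝ) (F G H : Fin n → ℝ), 1 / (n : ℝ) * ∑ i, (a * F i + c * G i - a * c * H i) =
          a * (1 / (n : ℝ) * ∑ i, F i) + c * (1 / (n : ℝ) * ∑ i, G i) -
            c * a * (1 / (n : ℝ) * ∑ i, H i) := by
        intro a c F G H
        rw [Finset.sum_sub_distrib, Finset.sum_add_distrib]
        simp only [← Finset.mul_sum]
        ring
      rw [← this]
      congr 1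
      refine Finset.sum_congr rfl fun i _ => ?_
      simp only [Pi.add_apply, Pi.sub_apply, Pi.smul_apply, smul_eq_mul]
      ring
    have hl2 := mul_le_mul_of_nonneg_left hl1 hlam
    rw [hq] at h0
    have h1 : t * (empNorm (X.mulVec b - y) ^ 2 + 2 * lam * l1Norm b + (1 - t) * D) ≤
        t * (empNorm (X.mulVec β - y) ^ 2 + 2 * lam * l1Norm β) := by nlinarith
    exact le_of_mul_le_mul_left h1 ht
  -- let `t` tend to `0`: the bound fails at `t = g / (g + D + 1)` if the gap `g` is positive
  by_contra hcon
  push Not at hcon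
  set g := empNorm (X.mulVec b - y) ^ 2 + 2 * lam * l1Norm b + D -
    (empNorm (X.mulVec β - y) ^ 2 + 2 * lam * l1Norm β) with hg
  have hg0 : 0 < g := by linarith
  have h1 := seg (g / (g + D + 1)) (by positivity) ((div_lt_one (by positivity)).2 (by linarith))
  have h2 : g / (g + D + 1) * D < g := by
    rw [div_mul_eq_mul_div, div_lt_iff₀ (by positivity)]
    nlinarith
  nlinarith

/-- The `s` largest absolute values dominate any `s` absolute values. -/
lemma sum_abs_le_sum_decrRearr {p s : ℕ} (hs : 1 ≤ s) (hsp : s ≤ p) (u : Fin p → ℝ)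
    {S : Finset (Fin p)} (hS : S.card = s) :
    ∑ j ∈ S, |u j| ≤ ∑ j : Fin p with j.val < s, decrRearr u j := by
  set π := Tuple.sort (fun i => -|u i|) with hπ
  have hanti : Antitone (decrRearr u) := by
    intro i j hij
    have := Tuple.monotone_sort (fun i => -|u i|) hij
    simp only [Function.comp_apply] at this
    exact neg_le_neg_iff.1 this
  set I : Finset (Fin p) := Finset.univ.filter fun j => j.val < s with hI
  have hIc : I.card = s := by
    rw [hI, Fin.card_filter_val_lt, min_eq_right hsp]
  set T := S.map π.symm.toEmbedding with hT
  have hTc : T.card = s := by rw [hT, Finset.card_map, hS]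
  have e1 : ∑ j ∈ S, |u j| = ∑ k ∈ T, decrRearr u k := by
    rw [hT, Finset.sum_map]
    refine Finset.sum_congr rfl fun j _ => ?_
    simp [decrRearr, hπ]
  rw [e1]
  -- compare with the threshold value `c`, the `s`-th largest one
  set c := decrRearr u ⟨s - 1, by omega⟩ with hc
  have hin : ∀ k ∈ I, 0 ≤ decrRearr u k - c := by
    intro k hk
    have hk' : k.val < s := by simpa [hI] using hk
    exact sub_nonneg.2 (hanti (Fin.mk_le_mk.2 (by omega : k.val ≤ s - 1)))
  have hout : ∀ k ∉ I, decrRearr u k - c ≤ 0 := by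
    intro k hk
    have hk' : s ≤ k.val := by simpa [hI] using hk
    exact sub_nonpos.2 (hanti (Fin.mk_le_mk.2 (by omega : s - 1 ≤ k.val)))
  have e2 : ∑ k ∈ T, (decrRearr u k - c) ≤ ∑ k ∈ I, (decrRearr u k - c) := by
    calc ∑ k ∈ T, (decrRearr u k - c)
        ≤ ∑ k ∈ T with k ∈ I, (decrRearr u k - c) := by
          rw [← Finset.sum_filter_add_sum_filter_not T (· ∈ I)]
          have := Finset.sum_nonpos (s := T.filter (· ∉ I)) (f := fun k => decrRearr u k - c)
            fun k hk => hout k (Finset.mem_filter.1 hk).2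
          linarith
      _ ≤ ∑ k ∈ I, (decrRearr u k - c) :=
          Finset.sum_le_sum_of_subset_of_nonneg (fun k hk => (Finset.mem_filter.1 hk).2)
            fun k hk _ => hin k hk
  simp only [Finset.sum_sub_distrib, Finset.sum_const, hTc, hIc] at e2
  linarith

/-- The restricted eigenvalue inequality for a vector whose `ℓ₁`-mass is concentrated on `S`. -/
lemma sum_abs_mul_reConst_le {n p s : ℕ} {X : Matrix (Fin n) (Fin p) ℝ} {c₀ : ℝ} (hs : 1 ≤ s)
    (hsp : s ≤ p) (hc₀ : 0 ≤ c₀) {S : Finset (Fin p)} (hS : S.card = s) {u : Fin p → ℝ}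
    (hu : ∑ j ∈ Sᶜ, |u j| ≤ c₀ * ∑ j ∈ S, |u j|) (hκ : 0 ≤ reConst X s c₀) :
    (∑ j ∈ S, |u j|) * reConst X s c₀ ≤ √s * empNorm (X.mulVec u) := by
  rcases eq_or_ne u 0 with rfl | hu0
  · simpa using mul_nonneg (Real.sqrt_nonneg _) (empNorm_nonneg _)
  have hl2 : 0 < l2Norm u := by
    obtain ⟨j, hj⟩ := Function.ne_iff.1 hu0
    refine Real.sqrt_pos.2 (Finset.sum_pos' (fun _ _ => by positivity) ⟨j, Finset.mem_univ _, ?_⟩)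
    have : 0 < |u j| := abs_pos.2 hj
    positivity
  have hcone : u ∈ reCone p s c₀ := by
    show l1Norm u ≤ _
    rw [l1Norm, ← Finset.sum_add_sum_compl S]
    have := mul_le_mul_of_nonneg_left (sum_abs_le_sum_decrRearr hs hsp u hS)
      (by linarith : 0 ≤ 1 + c₀)
    linarith
  have hre : reConst X s c₀ ≤ empNorm (X.mulVec u) / l2Norm u := by
    refine csInf_le ⟨0, ?_⟩ ⟨u, ⟨hcone, hu0⟩, rfl⟩
    rintro _ ⟨v, _, rfl⟩
    exact div_nonneg (empNorm_nonneg _) (Real.sqrt_nonneg _)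
  have hcs : ∑ j ∈ S, |u j| ≤ √s * l2Norm u := by
    rw [l2Norm, ← Real.sqrt_mul (Nat.cast_nonneg s)]
    refine Real.le_sqrt_of_sq_le (sq_sum_le_card_mul_sum_sq.trans ?_)
    rw [hS]
    exact mul_le_mul_of_nonneg_left (Finset.sum_le_sum_of_subset_of_nonneg (Finset.subset_univ _)
      fun _ _ _ => by positivity) (Nat.cast_nonneg s)
  calc (∑ j ∈ S, |u j|) * reConst X s c₀ ≤ √s * l2Norm u * (empNorm (X.mulVec u) / l2Norm u) :=
        mul_le_mul hcs hre hκ (mul_nonneg (Real.sqrt_nonneg _) hl2.le)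
    _ = √s * empNorm (X.mulVec u) := by field_simp

/-- With no observation all prediction norms vanish, which the restricted eigenvalue condition
excludes. -/
lemma RECondition.pos {n p s : ℕ} {X : Matrix (Fin n) (Fin p) ℝ} {c₀ : ℝ} (hs : 1 ≤ s)
    (hsp : s ≤ p) (hc₀ : 0 ≤ c₀) (hX : RECondition X s c₀) : 0 < n := by
  rcases Nat.eq_zero_or_pos n with rfl | hn
  · obtain ⟨S, -, hS⟩ := Finset.exists_subset_card_eq
      (s := (Finset.univ : Finset (Fin p))) (n := s) (by simpa using hsp)
    obtain ⟨j, hj⟩ : S.Nonempty := Finset.card_pos.1 (by omega)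
    have h0 : ∑ i ∈ S, |(Pi.single j 1 : Fin p → ℝ) i| = 1 := by
      rw [Finset.sum_eq_single_of_mem j hj (fun i _ hi => by simp [hi])]
      simp
    have h1 : ∑ i ∈ Sᶜ, |(Pi.single j 1 : Fin p → ℝ) i| = 0 := by
      refine Finset.sum_eq_zero fun i hi => ?_
      have : i ≠ j := by rintro rfl; exact Finset.mem_compl.1 hi hj
      simp [this]
    have := sum_abs_mul_reConst_le (X := X) hs hsp hc₀ hS (u := Pi.single j 1)
      (by rw [h0, h1]; linarith) hX.2.le
    rw [h0, one_mul] at this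
    have h2 : empNorm (X.mulVec (Pi.single j 1)) = 0 := by simp [empNorm]
    rw [h2, mul_zero] at this
    exact absurd hX.2 (not_lt.2 this)
  · exact hn

lemma l1Norm_sub_le {p : ℕ} {S : Finset (Fin p)} {β : Fin p → ℝ} (hβ : ∀ j ∉ S, β j = 0)
    (b : Fin p → ℝ) :
    l1Norm β - l1Norm b ≤ ∑ j ∈ S, |(b - β) j| - ∑ j ∈ Sᶜ, |(b - β) j| := by
  have h1 : ∑ j ∈ Sᶜ, |β j| = 0 :=
    Finset.sum_eq_zero fun j hj => by rw [hβ j (Finset.mem_compl.1 hj), abs_zero]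
  have h2 : ∑ j ∈ Sᶜ, |(b - β) j| = ∑ j ∈ Sᶜ, |b j| :=
    Finset.sum_congr rfl fun j hj => by rw [Pi.sub_apply, hβ j (Finset.mem_compl.1 hj), sub_zero]
  have h3 : ∑ j ∈ S, |β j| ≤ ∑ j ∈ S, |b j| + ∑ j ∈ S, |(b - β) j| := by
    rw [← Finset.sum_add_distrib]
    refine Finset.sum_le_sum fun j _ => ?_
    have := abs_sub (b j) (b j - β j)
    rw [sub_sub_cancel] at this
    exact this
  rw [l1Norm, l1Norm, ← Finset.sum_add_sum_compl S, ← Finset.sum_add_sum_compl S (fun j => |b j|),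
    h1, h2]
  linarith

/-- The linear span of the columns of `X` with index in `S`. -/
def colSpan {n p : ℕ} (X : Matrix (Fin n) (Fin p) ℝ) (S : Finset (Fin p)) :
    Submodule ℝ (EuclideanSpace ℝ (Fin n)) :=
  Submodule.span ℝ (designCol X '' S)

/-- The noise term of a direction `u`: the part of the noise in the span of the columns in `S` is
paid for by its norm, the orthogonal part by the coefficients outside `S`. -/
lemma inner_toLp_mulVec_le {n p : ℕ} (X : Matrix (Fin n) (Fin p) ℝ) (S : Finset (Fin p)) {r : ℝ}
    {η : EuclideanSpace ℝ (Fin n)}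
    (hη : ∀ j ∉ S, |⟪designCol X j, (colSpan X S)ᗮ.starProjection η⟫| ≤ r)
    (u : Fin p → ℝ) :
    ⟪WithLp.toLp 2 (X.mulVec u), η⟫ ≤
      ‖WithLp.toLp 2 (X.mulVec u)‖ * ‖(colSpan X S).starProjection η‖ + r * ∑ j ∈ Sᶜ, |u j| := by
  set w := WithLp.toLp 2 (X.mulVec u) with hw
  have hsplit : (colSpan X S).starProjection η + (colSpan X S)ᗮ.starProjection η = η :=
    Submodule.starProjection_add_starProjection_orthogonal η
  have h2 : ⟪w, (colSpan X S)ᗮ.starProjection η⟫ ≤ r * ∑ j ∈ Sᶜ, |u j| := by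
    rw [hw, toLp_mulVec_eq_sum, sum_inner, ← Finset.sum_add_sum_compl S, Finset.mul_sum]
    have h0 : ∑ j ∈ S, ⟪u j • designCol X j, (colSpan X S)ᗮ.starProjection η⟫ = 0 := by
      refine Finset.sum_eq_zero fun j hj => ?_
      have hjV : designCol X j ∈ colSpan X S :=
        Submodule.subset_span (Set.mem_image_of_mem _ (Finset.mem_coe.2 hj))
      rw [real_inner_smul_left, Submodule.inner_right_of_mem_orthogonal hjV ((colSpan X S)ᗮ.starProjection_apply_mem η), mul_zero]
    rw [h0, zero_add]
    refine Finset.sum_le_sum fun j hj => ?_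
    rw [real_inner_smul_left]
    calc _ ≤ |u j * ⟪designCol X j, (colSpan X S)ᗮ.starProjection η⟫| := le_abs_self _
      _ = |⟪designCol X j, (colSpan X S)ᗮ.starProjection η⟫| * |u j| := by rw [abs_mul, mul_comm]
      _ ≤ r * |u j| := mul_le_mul_of_nonneg_right (hη j (Finset.mem_compl.1 hj)) (abs_nonneg _)
  calc ⟪w, η⟫ = ⟪w, (colSpan X S).starProjection η⟫ + ⟪w, (colSpan X S)ᗮ.starProjection η⟫ := by
        rw [← inner_add_right, hsplit]
    _ ≤ _ := add_le_add (real_inner_le_norm _ _) h2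

/-- Deterministic oracle inequality. The noise is `σ ζ`, and `ζ` is compared with a vector `η` whose
correlations with the columns outside `S` are small once the span of the columns in `S` is projected
out. -/
theorem IsLasso.oracle_inequality {n p s : ℕ} (hs : 1 ≤ s) (hsp : s ≤ p) {σ ε : ℝ}
    (hσ : 0 < σ) (hε : 0 < ε) {X : Matrix (Fin n) (Fin p) ℝ}
    (hX : RECondition X s (1 + 1 / ε)) {f : Fin n → ℝ} {S : Finset (Fin p)} (hS : S.card = s)
    {ζ η : EuclideanSpace ℝ (Fin n)}
    (hη : ∀ j ∉ S, |⟪designCol X j, (colSpan X S)ᗮ.starProjection η⟫| ≤ √(2 * n * Real.log p))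
    {b : Fin p → ℝ}
    (hb : IsLasso X (f + (σ • ζ).ofLp) ((1 + ε) * σ * √(2 * Real.log p / n)) b)
    {β : Fin p → ℝ} (hβ : ∀ j ∉ S, β j = 0) :
    empNorm (X.mulVec b - f) ^ 2 ≤ empNorm (X.mulVec β - f) ^ 2 +
      σ ^ 2 / n * ((1 + ε) * √(2 * s * Real.log p) / reConst X s (1 + 1 / ε) +
        (‖(colSpan X S).starProjection η‖ + ‖ζ - η‖)) ^ 2 := by
  have hc₀ : 0 ≤ 1 + 1 / ε := by positivity
  have hn : (0 : ℝ) < n := by exact_mod_cast hX.pos hs hsp hc₀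
  have hlog := Real.log_natCast_nonneg p
  have hκ := hX.2
  set κ := reConst X s (1 + 1 / ε) with hκd
  set r := √(2 * n * Real.log p) with hr
  set lam := (1 + ε) * σ * √(2 * Real.log p / n) with hlam
  set L := √(2 * Real.log p) with hL
  have hrL : r = √n * L := by
    rw [hr, hL, ← Real.sqrt_mul hn.le]; ring_nf
  have hnlam : n * lam = (1 + ε) * σ * r := by
    rw [hlam, Real.sqrt_div (by positivity), hrL, ← hL]
    calc n * ((1 + ε) * σ * (L / √n)) = (1 + ε) * σ * (n / √n * L) := by ring
      _ = (1 + ε) * σ * (√n * L) := by rw [Real.div_sqrt]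
  set u := b - β with hu
  set w := WithLp.toLp 2 (X.mulVec u) with hw
  set M := (1 + ε) * √(2 * s * Real.log p) / κ with hM
  set R := ‖(colSpan X S).starProjection η‖ + ‖ζ - η‖ with hR
  set q₁ := WithLp.toLp 2 (X.mulVec b - f) with hq₁
  set q₂ := WithLp.toLp 2 (X.mulVec β - f) with hq₂
  have hqw : q₁ - q₂ = w := by
    rw [hq₁, hq₂, hw, hu, Matrix.mulVec_sub, ← WithLp.toLp_sub, sub_sub_sub_cancel_right]
  have basic := hb.add_sq_le (by positivity) β
  have hres : ∀ v : Fin p → ℝ, WithLp.toLp 2 (X.mulVec v - (f + (σ • ζ).ofLp)) =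
      WithLp.toLp 2 (X.mulVec v - f) - σ • ζ := by
    intro v
    rw [← sub_sub, WithLp.toLp_sub]
  rw [empNorm_sq, empNorm_sq, empNorm_sq, hres, hres, norm_sub_sq_real, norm_sub_sq_real,
    ← hq₁, ← hq₂, ← hu, ← hw] at basic
  have hinner : ⟪w, σ • ζ⟫ = ⟪q₁, σ • ζ⟫ - ⟪q₂, σ • ζ⟫ := by rw [← hqw, inner_sub_left]
  have basic' : ‖q₁‖ ^ 2 + ‖w‖ ^ 2 ≤
      ‖q₂‖ ^ 2 + 2 * (⟪w, σ • ζ⟫ + n * lam * (l1Norm β - l1Norm b)) := by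
    have := mul_le_mul_of_nonneg_left basic hn.le
    have e : ∀ a c d : ℝ, n * (a / n + 2 * lam * c + d / n) = a + 2 * (n * lam) * c + d := by
      intro a c d; field_simp
    have e' : ∀ a c : ℝ, n * (a / n + 2 * lam * c) = a + 2 * (n * lam) * c := by
      intro a c; field_simp
    rw [e, e'] at this
    rw [hinner]
    linarith
  set a := ∑ j ∈ S, |u j| with ha
  set d := ∑ j ∈ Sᶜ, |u j| with hd
  have hl1 : l1Norm β - l1Norm b ≤ a - d := l1Norm_sub_le hβ b
  have ha0 : 0 ≤ a := Finset.sum_nonneg fun _ _ => abs_nonneg _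
  have hr0 : 0 ≤ r := Real.sqrt_nonneg _
  have hM0 : 0 ≤ M := by positivity
  have hre : r * ((1 + ε) * a - ε * d) ≤ M * ‖w‖ := by
    -- either the `ℓ₁` terms are harmless, or `u` lies in the cone
    rcases le_or_gt ((1 + ε) * a - ε * d) 0 with hneg | hpos
    · exact (mul_nonpos_of_nonneg_of_nonpos hr0 hneg).trans (by positivity)
    have hcone : d ≤ (1 + 1 / ε) * a := by
      have : (1 + 1 / ε) * a = ((1 + ε) * a) / ε := by field_simp; ring
      rw [this, le_div_iff₀ hε]
      linarith
    have hd0 : 0 ≤ d := Finset.sum_nonneg fun _ _ => abs_nonneg _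
    have key : a * κ ≤ √s * empNorm (X.mulVec u) := sum_abs_mul_reConst_le hs hsp hc₀ hS hcone hκ.le
    have hsL : √(2 * s * Real.log p) = √s * L := by
      rw [hL, ← Real.sqrt_mul (Nat.cast_nonneg s)]; ring_nf
    calc r * ((1 + ε) * a - ε * d) ≤ r * ((1 + ε) * a) :=
          mul_le_mul_of_nonneg_left (by nlinarith) hr0
      _ = (1 + ε) * r / κ * (a * κ) := by field_simp
      _ ≤ (1 + ε) * r / κ * (√s * empNorm (X.mulVec u)) :=
          mul_le_mul_of_nonneg_left key (by positivity)
      _ = M * ‖w‖ := by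
          rw [hM, hsL, hw, norm_toLp_eq_sqrt_mul_empNorm (hX.pos hs hsp hc₀), hrL]
          ring
  have hnoise : ⟪w, ζ⟫ ≤ ‖w‖ * R + r * d := by
    have h1 := inner_toLp_mulVec_le X S hη u
    rw [← hw, ← hd] at h1
    have h2 := real_inner_le_norm w (ζ - η)
    rw [inner_sub_right] at h2
    rw [hR, mul_add]
    linarith
  have hlin : ⟪w, σ • ζ⟫ + n * lam * (l1Norm β - l1Norm b) ≤ σ * ((M + R) * ‖w‖) := by
    rw [real_inner_smul_right, hnlam]
    have h1 : (1 + ε) * σ * r * (l1Norm β - l1Norm b) ≤ (1 + ε) * σ * r * (a - d) :=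
      mul_le_mul_of_nonneg_left hl1 (by positivity)
    calc _ ≤ σ * (‖w‖ * R + r * d) + (1 + ε) * σ * r * (a - d) :=
          add_le_add (mul_le_mul_of_nonneg_left hnoise hσ.le) h1
      _ = σ * (‖w‖ * R + r * ((1 + ε) * a - ε * d)) := by ring
      _ ≤ σ * ((M + R) * ‖w‖) := mul_le_mul_of_nonneg_left (by linarith) hσ.le
  have hfin : ‖q₁‖ ^ 2 ≤ ‖q₂‖ ^ 2 + σ ^ 2 * (M + R) ^ 2 := by
    have h1 : 2 * (σ * ((M + R) * ‖w‖)) ≤ σ ^ 2 * (M + R) ^ 2 + ‖w‖ ^ 2 := by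
      have := sq_nonneg (σ * (M + R) - ‖w‖)
      have e : (σ * (M + R) - ‖w‖) ^ 2 =
        σ ^ 2 * (M + R) ^ 2 + ‖w‖ ^ 2 - 2 * (σ * ((M + R) * ‖w‖)) := by ring
      linarith
    linarith
  rw [empNorm_sq, empNorm_sq, div_mul_eq_mul_div, ← add_div]
  exact div_le_div_of_nonneg_right hfin hn.le

/-! ### The noise event and the support -/

lemma multivariateGaussian_zero_sq_smul_one {n : ℕ} (σ : ℝ) :
    multivariateGaussian 0 (σ ^ 2 • (1 : Matrix (Fin n) (Fin n) ℝ)) =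
      (stdGaussian (EuclideanSpace ℝ (Fin n))).map (fun x => σ • x) := by
  refine Measure.ext_of_charFun (E := EuclideanSpace ℝ (Fin n)) ?_
  ext t
  rw [charFun_multivariateGaussian (Matrix.PosSemidef.one.smul (sq_nonneg σ)), charFun_map_smul,
    charFun_stdGaussian]
  congr 1
  rw [← Complex.ofReal_pow, norm_smul, mul_pow, EuclideanSpace.real_norm_sq_eq, Real.norm_eq_abs, sq_abs,
    Matrix.smul_mulVec, Matrix.one_mulVec, dotProduct_smul, dotProduct]
  simp only [inner_zero_right, smul_eq_mul, ← sq]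
  push_cast
  ring

lemma norm_designCol_sq_le {n p s : ℕ} {X : Matrix (Fin n) (Fin p) ℝ} {c₀ : ℝ}
    (hX : RECondition X s c₀) (hn : 0 < n) (j : Fin p) : ‖designCol X j‖ ^ 2 ≤ n := by
  have h1 : empNorm (X.mulVec (Pi.single j 1)) ^ 2 ≤ 1 :=
    pow_le_one₀ (empNorm_nonneg _) (hX.1 j)
  rw [empNorm_sq, div_le_one (by exact_mod_cast hn)] at h1
  exact h1

lemma finrank_colSpan_le {n p : ℕ} (X : Matrix (Fin n) (Fin p) ℝ) (S : Finset (Fin p)) :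
    Module.finrank ℝ (colSpan X S) ≤ S.card := by
  classical
  rw [colSpan, ← Finset.coe_image]
  exact (finrank_span_finset_le_card _).trans Finset.card_image_le

/-- The noise vectors whose correlation with each column outside `S` is at most `√(2 n log p)`. -/
def smallCorr {n p : ℕ} (X : Matrix (Fin n) (Fin p) ℝ) (S : Finset (Fin p)) :
    Set (EuclideanSpace ℝ (Fin n)) :=
  {v | ∀ j ∉ S, |⟪designCol X j, v⟫| ≤ √(2 * n * Real.log p)}

lemma isClosed_smallCorr {n p : ℕ} (X : Matrix (Fin n) (Fin p) ℝ) (S : Finset (Fin p)) :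
    IsClosed (smallCorr X S) := by
  simp only [smallCorr, Set.ofPred_forall]
  exact isClosed_iInter fun j => isClosed_iInter fun _ =>
    isClosed_le (by fun_prop) continuous_const

/-- Union bound over the columns outside `S`. -/
lemma stdGaussian_smallCorr_ge {n p s : ℕ} (hp : 2 ≤ p) {X : Matrix (Fin n) (Fin p) ℝ} {c₀ : ℝ}
    (hX : RECondition X s c₀) (hn : 0 < n) (S : Finset (Fin p)) (V : Submodule ℝ _) :
    1 / 4 ≤ (stdGaussian (EuclideanSpace ℝ (Fin n))).real
      (V.starProjection ⁻¹' smallCorr X S) := by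
  set γ := stdGaussian (EuclideanSpace ℝ (Fin n))
  have hp' : (0 : ℝ) < p := by exact_mod_cast (by omega : 0 < p)
  have hm : MeasurableSet (V.starProjection ⁻¹' smallCorr X S) :=
    (isClosed_smallCorr X S).measurableSet.preimage (by fun_prop)
  have hsub : (V.starProjection ⁻¹' smallCorr X S)ᶜ ⊆
      ⋃ j ∈ Sᶜ, {x | √(2 * n * Real.log p) < |⟪V.starProjection (designCol X j), x⟫|} := by
    intro x hx
    have hx' : ¬ ∀ j ∉ S, |⟪designCol X j, V.starProjection x⟫| ≤ √(2 * n * Real.log p) := hx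
    push Not at hx'
    obtain ⟨j, hj, hlt⟩ := hx'
    refine Set.mem_iUnion₂.2 ⟨j, Finset.mem_compl.2 hj, ?_⟩
    rw [Set.mem_ofPred_eq, V.inner_starProjection_left_eq_right]
    exact hlt
  have hle : γ.real (V.starProjection ⁻¹' smallCorr X S)ᶜ ≤ 3 / 4 := by
    calc _ ≤ γ.real (⋃ j ∈ Sᶜ,
            {x | √(2 * n * Real.log p) < |⟪V.starProjection (designCol X j), x⟫|}) :=
          measureReal_mono hsub (measure_ne_top _ _)
      _ ≤ ∑ j ∈ Sᶜ, γ.real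
            {x | √(2 * n * Real.log p) < |⟪V.starProjection (designCol X j), x⟫|} :=
          measureReal_biUnion_finset_le _ _
      _ ≤ ∑ _j : Fin p, 3 / 4 / (p : ℝ) := by
          refine (Finset.sum_le_sum fun j _ => ?_).trans
            (Finset.sum_le_sum_of_subset_of_nonneg (Finset.subset_univ _)
              fun _ _ _ => by positivity)
          refine stdGaussian_abs_inner_gt_le hp (le_trans ?_ (norm_designCol_sq_le hX hn j))
          exact pow_le_pow_left₀ (norm_nonneg _) (V.norm_starProjection_apply_le _) 2
      _ = 3 / 4 := by
          rw [Finset.sum_const, Finset.card_univ, Fintype.card_fin, nsmul_eq_mul]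
          field_simp
  rw [probReal_compl_eq_one_sub hm] at hle
  linarith

/-- The infimum over `s`-sparse vectors is governed by one deterministic support of size `s`. -/
lemma exists_support_le_iInf {p s : ℕ} (hsp : s ≤ p) (F : (Fin p → ℝ) → ℝ) (hF : ∀ β, 0 ≤ F β) :
    ∃ S : Finset (Fin p), S.card = s ∧ ∀ c, (∀ β, (∀ j ∉ S, β j = 0) → c ≤ F β) →
      c ≤ ⨅ β : {β : Fin p → ℝ // l0Norm β ≤ s}, F β.1 := by
  have hne : (Finset.univ.powersetCard s : Finset (Finset (Fin p))).Nonempty :=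
    Finset.powersetCard_nonempty.2 (by simpa using hsp)
  obtain ⟨S, hS, hmin⟩ := Finset.exists_min_image _
    (fun S : Finset (Fin p) => ⨅ β : {β : Fin p → ℝ // ∀ j ∉ S, β j = 0}, F β.1) hne
  refine ⟨S, (Finset.mem_powersetCard.1 hS).2, fun c hc => ?_⟩
  have : Nonempty {β : Fin p → ℝ // l0Norm β ≤ s} := ⟨0, by simp [l0Norm]⟩
  refine le_ciInf fun β => ?_
  obtain ⟨S', hS', hS'c⟩ := Finset.exists_superset_card_eq
    (s := Finset.univ.filter fun j => β.1 j ≠ 0) (n := s) β.2 (by simpa using hsp)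
  have hβS : ∀ j ∉ S', β.1 j = 0 := by
    intro j hj
    by_contra hne
    exact hj (hS' (by simpa using hne))
  have : Nonempty {β : Fin p → ℝ // ∀ j ∉ S, β j = 0} := ⟨0, by simp⟩
  calc c ≤ ⨅ β : {β : Fin p → ℝ // ∀ j ∉ S, β j = 0}, F β.1 := le_ciInf fun β => hc β.1 β.2
    _ ≤ ⨅ β : {β : Fin p → ℝ // ∀ j ∉ S', β j = 0}, F β.1 :=
        hmin S' (Finset.mem_powersetCard.2 ⟨Finset.subset_univ _, hS'c⟩)
    _ ≤ F β.1 := ciInf_le (f := fun β : {β : Fin p → ℝ // ∀ j ∉ S', β j = 0} => F β.1)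
        ⟨0, by rintro _ ⟨v, rfl⟩; exact hF v.1⟩ ⟨β.1, hβS⟩

theorem mainTheorem10 {Ω : Type*} [MeasurableSpace Ω] (P : Measure Ω) [IsProbabilityMeasure P]
    (n p s : ℕ) (hp : 2 ≤ p) (hs1 : 1 ≤ s) (hsp : s ≤ p)
    (σ ε : ℝ) (hσ : 0 < σ) (hε : 0 < ε)
    (X : Matrix (Fin n) (Fin p) ℝ) (hX : RECondition X s (1 + 1 / ε))
    (f : Fin n → ℝ)
    (ξ : Ω → EuclideanSpace ℝ (Fin n))
    (hξ : HasLaw ξ (multivariateGaussian 0 (σ ^ 2 • (1 : Matrix (Fin n) (Fin n) ℝ))) P)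
    (βhat : Ω → Fin p → ℝ)
    (hβ : ∀ᵐ ω ∂P, IsLasso X (f + (ξ ω).ofLp)
      ((1 + ε) * σ * Real.sqrt (2 * Real.log p / n)) (βhat ω)) :
    ∀ δ : ℝ, 0 < δ → δ < 1 →
      1 - δ ≤ P.real {ω |
        empNorm (X.mulVec (βhat ω) - f) ^ 2 ≤
          (⨅ β : {β : Fin p → ℝ // l0Norm β ≤ s}, empNorm (X.mulVec β.1 - f) ^ 2) +
            σ ^ 2 / n *
              ((1 + ε) * Real.sqrt (2 * s * Real.log p) / reConst X s (1 + 1 / ε) +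
                Real.sqrt s + Real.sqrt (2 * Real.log (1 / δ)) + 2.8) ^ 2} := by
  intro δ hδ hδ1
  have hc₀ : 0 ≤ 1 + 1 / ε := by positivity
  have hn : 0 < n := hX.pos hs1 hsp hc₀
  obtain ⟨S, hS, hSinf⟩ := exists_support_le_iInf hsp (fun β => empNorm (X.mulVec β - f) ^ 2)
    fun β => sq_nonneg _
  set V := colSpan X S with hV
  set γ := stdGaussian (EuclideanSpace ℝ (Fin n)) with hγ
  set M := (1 + ε) * Real.sqrt (2 * s * Real.log p) / reConst X s (1 + 1 / ε) with hM
  set t := Real.sqrt (2 * Real.log (1 / δ)) with ht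
  have hM0 : 0 ≤ M :=
    div_nonneg (mul_nonneg (by positivity) (Real.sqrt_nonneg _)) hX.2.le
  set U := {x : EuclideanSpace ℝ (Fin n) | ∃ y, Vᗮ.starProjection y ∈ smallCorr X S ∧
    ‖V.starProjection y‖ + ‖x - y‖ < √s + t + 2.8} with hU
  have hUo : IsOpen U := isOpen_enlargement (Vᗮ.starProjection ⁻¹' smallCorr X S) _ _
  have hrank : (Module.finrank ℝ V : ℝ) ≤ √s ^ 2 := by
    rw [Real.sq_sqrt (Nat.cast_nonneg s), ← hS]
    exact_mod_cast finrank_colSpan_le X S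
  -- the additive constant `2.8` enters only through `exp (-2.8² / 2) ≤ 1 / 4`, the lower bound on
  -- the probability of small correlations
  have hexp : Real.exp (-(2.8 : ℝ) ^ 2 / 2) ≤ 1 / 4 := by
    rw [neg_div, Real.exp_neg, ← one_div]
    refine one_div_le_one_div_of_le (by norm_num) ?_
    have := Real.add_one_le_exp ((2.8 : ℝ) ^ 2 / 2)
    norm_num at this ⊢
    linarith
  have hconc : 1 - δ ≤ γ.real U :=
    stdGaussian_enlargement_ge V (isClosed_smallCorr X S).measurableSet (by norm_num)
      (Real.sqrt_pos.2 (by exact_mod_cast hs1)) hrank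
      (hexp.trans (stdGaussian_smallCorr_ge hp hX hn S _)) hδ hδ1
  have hlaw : P.real (ξ ⁻¹' ((fun x => σ⁻¹ • x) ⁻¹' U)) = γ.real U := by
    have hUm : MeasurableSet ((fun x : EuclideanSpace ℝ (Fin n) => σ⁻¹ • x) ⁻¹' U) :=
      hUo.measurableSet.preimage (by fun_prop)
    rw [← map_measureReal_apply_of_aemeasurable hξ.aemeasurable hUm, hξ.map_eq,
      multivariateGaussian_zero_sq_smul_one, map_measureReal_apply (by fun_prop) hUm]
    congr 1
    ext x
    simp [smul_smul, hσ.ne']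
  rw [← hlaw] at hconc
  -- `βhat` need not be measurable, so compare with the measurable event `σ⁻¹ ξ ∈ U`
  refine hconc.trans (ENNReal.toReal_mono (measure_ne_top _ _) (measure_mono_ae ?_))
  filter_upwards [hβ] with ω hω hmem
  obtain ⟨η, hηA, hηlt⟩ : σ⁻¹ • ξ ω ∈ U := hmem
  have hξω : ξ ω = σ • σ⁻¹ • ξ ω := by rw [smul_smul, mul_inv_cancel₀ hσ.ne', one_smul]
  rw [hξω] at hω
  -- one event serves all `β` supported in `S`, so the infimum can be taken after fixing `ω`
  refine sub_le_iff_le_add.1 (hSinf _ fun β hβS => ?_)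
  rw [sub_le_iff_le_add]
  refine (hω.oracle_inequality hs1 hsp hσ hε hX hS hηA hβS).trans ?_
  refine add_le_add_right (mul_le_mul_of_nonneg_left ?_ (by positivity)) _
  refine pow_le_pow_left₀ (by positivity) ?_ 2
  linarith
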